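/- Conventions. All systems are finite-dimensional, each with a fixed orthonormal basis; $\log=\log_2$. A channel $\mathcal N_A\in\mathrm{CPTP}(A_0\to A_1)$ is a completely positive trace-preserving linear map from operators on $A_0$ (with $|A_0|\ge 1$) to operators on $A_1$. A supermap $\Theta$ from $A=(A_0\to A_1)$ to $B=(B_0\to B_1)$ is a linear map taking linear maps on operators $A_0\to A_1$ to linear maps on operators $B_0\to B_1$; it is a superchannel if, for every $R=(R_0\to R_1)$, $\mathbb 1_R\otimes\Theta$ takes channels $R_0A_0\to R_1A_1$ to channels $R_0B_0\to R_1B_1$. Let $\mathcal D_{X}(\rho)=\sum_i|i\rangle\langle i|\rho|i\rangle\langle i|$ be the completely dephasing channel of a system $X$ and let $\Delta_A[\mathcal N]=\mathcal D_{A_1}\circ\mathcal N\circ\mathcal D_{A_0}$; the basis of a tensor product is the product basis. A superchannel $\Theta$ is in $\mathrm{DISC}(A\to B)$ if $\Delta_B\circ\Theta=\Theta\circ\Delta_A$. For maps $\mathcal N,\mathcal E$ let $D_{\max}(\mathcal N\|\mathcal E)=\log\min\{t\in\mathbb R: t\mathcal E-\mathcal N\text{ is completely positive}\}$, and let $LR_\Delta(\mathcal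 N_A)=D_{\max}(\mathcal N_A\|\Delta_A[\mathcal N_A])$ be the dephasing log-robustness. For a static system $R_1$ with $|R_1|\ge 1$ (a dynamical system with one-dimensional input) let $\phi^+_{R_1}=\frac1{|R_1|}\sum_{i,j}|i\rangle\langle j|$ be the maximally coherent state. The exact single-shot coherence cost of $\mathcal N_A$ under DISC is $$C^0_{\mathrm{DISC}}(\mathcal N_A)=\min\{\log|R_1| : \exists\,\Theta\in\mathrm{DISC}(R_1\to A)\ \text{with}\ \Theta[\phi^+_{R_1}]=\mathcal N_A\},$$ and the exact asymptotic coherence cost is $C^{\mathrm{exact}}_{\mathrm{DISC}}(\mathcal N_A)=\lim_{n\to\infty}\frac1n C^0_{\mathrm{DISC}}(\mathcal N_A^{\otimes n})$. Theorem. For every channel $\mathcal N_A\in\mathrm{CPTP}(A_0\to A_1)$, the minimum defining $LR_\Delta(\mathcal N_A)$ and the minima defining $C^0_{\mathrm{DISC}}(\mathcal N_A^{\otimes n})$, $n\ge 0$, exist, the limit defining $C^{\mathrm{exact}}_{\mathrm{DISC}}(\mathcal N_A)$ exists, and $$C^{\mathrm{exact}}_{\mathrm{DISC}}(\mathcal N_A)=LR_\Delta(\mathcal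 N_A).$$ -/

import Mathlib

open scoped Kronecker ComplexOrder

namespace DynCoh

/-- `𝔏(A₀ → A₁)`: linear maps between the matrix algebras of two finite-dimensional systems.
A finite-dimensional system with its fixed (incoherent) orthonormal basis is a finite type,
whose elements label the basis vectors. -/
abbrev MapSpace (a₀ a₁ : Type) : Type := Matrix a₀ a₀ ℂ →ₗ[ℂ] Matrix a₁ a₁ ℂ

/-- `𝔏(A → B)`: supermaps, i.e. linear maps from `𝔏(A₀ → A₁)` to `𝔏(B₀ → B₁)`. -/
abbrev Supermap (a₀ a₁ b₀ b₁ : Type) : Type := MapSpace a₀ a₁ →ₗ[ℂ] MapSpace b₀ b₁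

/-! ### Channels -/

/-- The action of `id_K ⊗ N` on an operator of the composite system `K A₀`: the map `N` is
applied to every `K`-block. -/
def idTensor {a₀ a₁ : Type} (k : Type) (N : MapSpace a₀ a₁)
    (X : Matrix (k × a₀) (k × a₀) ℂ) : Matrix (k × a₁) (k × a₁) ℂ :=
  Matrix.of fun p q => N (Matrix.of fun x x' => X (p.1, x) (q.1, x')) p.2 q.2

/-- Complete positivity: `id_K ⊗ N` preserves positive semidefiniteness for every
finite-dimensional ancilla `K`. -/
def IsCP {a₀ a₁ : Type} (N : MapSpace a₀ a₁) : Prop :=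
  ∀ (k : Type) [Fintype k] (X : Matrix (k × a₀) (k × a₀) ℂ),
    X.PosSemidef → (idTensor k N X).PosSemidef

/-- Quantum channels: completely positive trace-preserving maps. -/
structure IsChannel {a₀ a₁ : Type} [Fintype a₀] [Fintype a₁] (N : MapSpace a₀ a₁) : Prop where
  cp : IsCP N
  tp : ∀ X : Matrix a₀ a₀ ℂ, (N X).trace = X.trace

/-- The `n`-fold tensor power `N^{⊗ n}`; the basis of `A₀^{⊗ n}` is labelled by `Fin n → a₀`.
Explicitly, `N^{⊗ n}(|x⟩⟨x'|) = ⨂ᵢ N(|xᵢ⟩⟨x'ᵢ|)`, extended linearly. -/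
def tensorPow {a₀ a₁ : Type} [Fintype a₀] [DecidableEq a₀] (N : MapSpace a₀ a₁) (n : ℕ) :
    MapSpace (Fin n → a₀) (Fin n → a₁) where
  toFun X := Matrix.of fun y y' =>
    ∑ x, ∑ x', X x x' * ∏ i, N (Matrix.single (x i) (x' i) 1) (y i) (y' i)
  map_add' X Y := by
    ext y y'
    simp [add_mul, Finset.sum_add_distrib]
  map_smul' c X := by
    ext y y'
    simp [Finset.mul_sum, mul_assoc]

/-! ### Superchannels -/

/-- The block of a bipartite map `N ∈ 𝔏(R₀A₀ → R₁A₁)` at `i, j` (basis of `R₀`) and `k, l`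
(basis of `R₁`): the map `X ↦ (⟨k| ⊗ I) N(|i⟩⟨j| ⊗ X) (|l⟩ ⊗ I)` in `𝔏(A₀ → A₁)`. -/
def block {r₀ r₁ a₀ a₁ : Type} [DecidableEq r₀] (N : MapSpace (r₀ × a₀) (r₁ × a₁))
    (i j : r₀) (k l : r₁) : MapSpace a₀ a₁ where
  toFun X := Matrix.of fun y y' => N (Matrix.single i j (1 : ℂ) ⊗ₖ X) (k, y) (l, y')
  map_add' X Y := by
    ext y y'
    simp [Matrix.kronecker_add]
  map_smul' c X := by
    ext y y'
    simp [Matrix.kronecker_smul]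

/-- `(𝟙_R ⊗ Θ)[N]`: the supermap `Θ` applied to the `A`-part of a bipartite map
`N ∈ 𝔏(R₀A₀ → R₁A₁)`, i.e. to every block of `N`. -/
def idTensorSuper {r₀ r₁ a₀ a₁ b₀ b₁ : Type} [Fintype r₀] [DecidableEq r₀]
    (Θ : Supermap a₀ a₁ b₀ b₁) (N : MapSpace (r₀ × a₀) (r₁ × a₁)) :
    MapSpace (r₀ × b₀) (r₁ × b₁) where
  toFun Y := Matrix.of fun p q =>
    ∑ i, ∑ j, Θ (block N i j p.1 q.1) (Matrix.of fun b b' => Y (i, b) (j, b')) p.2 q.2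
  map_add' X Y := by
    ext p q
    simp only [Matrix.of_apply, Matrix.add_apply, ← Finset.sum_add_distrib]
    refine Finset.sum_congr rfl fun i _ => Finset.sum_congr rfl fun j _ => ?_
    rw [← Matrix.add_apply, ← map_add]
    rfl
  map_smul' c X := by
    ext p q
    simp only [Matrix.of_apply, Matrix.smul_apply, Finset.smul_sum, RingHom.id_apply]
    refine Finset.sum_congr rfl fun i _ => Finset.sum_congr rfl fun j _ => ?_
    rw [← Matrix.smul_apply, ← map_smul]
    rfl

/-- Superchannels: supermaps that take channels to channels, also when tensored with the identity
supermap of an arbitrary dynamical system `R = (R₀ → R₁)`. -/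
def IsSuperchannel {a₀ a₁ b₀ b₁ : Type} [Fintype a₀] [Fintype a₁] [Fintype b₀] [Fintype b₁]
    (Θ : Supermap a₀ a₁ b₀ b₁) : Prop :=
  ∀ (r₀ r₁ : Type) [Fintype r₀] [DecidableEq r₀] [Fintype r₁]
    (N : MapSpace (r₀ × a₀) (r₁ × a₁)), IsChannel N → IsChannel (idTensorSuper Θ N)

/-! ### Dephasing and DISC -/

/-- The completely dephasing channel `𝒟(X) = ∑ᵢ |i⟩⟨i| X |i⟩⟨i|`. -/
def dephase (a : Type) [DecidableEq a] : MapSpace a a where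
  toFun X := Matrix.diagonal fun i => X i i
  map_add' X Y := by
    ext i j
    by_cases h : i = j <;> simp [h]
  map_smul' c X := by
    ext i j
    by_cases h : i = j <;> simp [h]

/-- The dephasing superchannel `Δ[N] = 𝒟_{A₁} ∘ N ∘ 𝒟_{A₀}`. -/
def dephaseSuper (a₀ a₁ : Type) [DecidableEq a₀] [DecidableEq a₁] : Supermap a₀ a₁ a₀ a₁ where
  toFun N := dephase a₁ ∘ₗ N ∘ₗ dephase a₀
  map_add' M N := by
    rw [LinearMap.add_comp, LinearMap.comp_add]
  map_smul' c N := by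
    rw [LinearMap.smul_comp, LinearMap.comp_smul, RingHom.id_apply]

/-- Dephasing incoherent superchannels (DISC): superchannels `Θ` with `Δ_B ∘ Θ = Θ ∘ Δ_A`. -/
structure IsDISC {a₀ a₁ b₀ b₁ : Type} [Fintype a₀] [DecidableEq a₀] [Fintype a₁] [DecidableEq a₁]
    [Fintype b₀] [DecidableEq b₀] [Fintype b₁] [DecidableEq b₁]
    (Θ : Supermap a₀ a₁ b₀ b₁) : Prop where
  superchannel : IsSuperchannel Θ
  covariant : dephaseSuper b₀ b₁ ∘ₗ Θ = Θ ∘ₗ dephaseSuper a₀ a₁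

/-! ### Max-relative entropy and dephasing log-robustness -/

/-- The set of real `t` with `t E ≥ N`, i.e. such that `t E - N` is completely positive. -/
def dominationSet {a₀ a₁ : Type} (N E : MapSpace a₀ a₁) : Set ℝ :=
  {t : ℝ | IsCP ((t : ℂ) • E - N)}

/-- The channel max-relative entropy `D_max(N‖E) = log₂ min {t : t E ≥ N}`. -/
noncomputable def dmax {a₀ a₁ : Type} (N E : MapSpace a₀ a₁) : ℝ :=
  Real.logb 2 (sInf (dominationSet N E))

/-- The dephasing log-robustness `LR_Δ(N) = D_max(N‖Δ[N])`. -/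
noncomputable def dephasingLogRobustness {a₀ a₁ : Type} [DecidableEq a₀] [DecidableEq a₁]
    (N : MapSpace a₀ a₁) : ℝ :=
  dmax N (dephaseSuper a₀ a₁ N)

/-! ### Exact coherence cost under DISC -/

/-- The maximally coherent state `φ⁺ = |+⟩⟨+|` of dimension `m`, all of whose entries
are `1 / m`. -/
noncomputable def plusState (m : ℕ) : Matrix (Fin m) (Fin m) ℂ :=
  Matrix.of fun _ _ => (m : ℂ)⁻¹

/-- A matrix `ρ` on `R₁`, viewed as a map with one-dimensional input system `R₀`. -/
def preparation {r₁ : Type} (ρ : Matrix r₁ r₁ ℂ) : MapSpace Unit r₁ where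
  toFun X := X () () • ρ
  map_add' X Y := by rw [Matrix.add_apply, add_smul]
  map_smul' c X := by rw [Matrix.smul_apply, smul_assoc, RingHom.id_apply]

/-- The set of values `log₂ |R₁|` over all static systems `R₁` from whose maximally coherent
state the map `N` can be produced exactly by a superchannel in `DISC(R₁ → A)`. -/
def exactCostSet {a₀ a₁ : Type} [Fintype a₀] [DecidableEq a₀] [Fintype a₁] [DecidableEq a₁]
    (N : MapSpace a₀ a₁) : Set ℝ :=
  {c : ℝ | ∃ m : ℕ, 0 < m ∧ c = Real.logb 2 m ∧
    ∃ Θ : Supermap Unit (Fin m) a₀ a₁, IsDISC Θ ∧ Θ (preparation (plusState m)) = N}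

/-- The exact single-shot coherence cost `C⁰_DISC(N)`. -/
noncomputable def exactCost {a₀ a₁ : Type} [Fintype a₀] [DecidableEq a₀] [Fintype a₁]
    [DecidableEq a₁] (N : MapSpace a₀ a₁) : ℝ :=
  sInf (exactCostSet N)

end DynCoh

/-! Let `t` be the least factor with `t Δ[N] - N` completely positive, so that the log-robustness of
`N` is `log t`. The single-shot cost turns out to be `log ⌈t⌉`. Converse
(`mem_dominationSet_of_isDISC`): the maximally coherent state `φ` of dimension `m` dephases to
`1/m`, so `m Δ[φ] - φ` is positive. A DISC superchannel sending `φ` to `N` preserves this inequality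
and commutes with dephasing, hence `m ≥ t`. Achievability (`exists_isDISC`): for an integer `m ≥ t`,
measure `{φ, 1 - φ}` and prepare `N` or `E`, where `(m - 1) E = m Δ[N] - N`. A dephased state gives
outcome `φ` with probability `1/m`, and the resulting mixture of `N` and `E` is exactly `Δ[N]`,
which is covariance. On Choi matrices, `Δ` keeps just the diagonal, and `t` compares a positive
matrix with its diagonal. This makes `t` multiplicative under tensor powers
(`sInf_dominationSet_tensorPow`), so the cost per copy is `log ⌈t ^ n⌉ / n`, which tends to `log t`.
-/

namespace DynCoh

open Matrix

/-! ### Positive semidefinite matrices: pinching, contraction, tensor powers. -/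

section Matrices

variable {m k c d : Type*} [Fintype m] [Fintype k] [Fintype c] [Fintype d]

/-- The real part of the quadratic form `v ↦ ⟨v, A v⟩`. -/
noncomputable def quadForm (A : Matrix m m ℂ) (v : m → ℂ) : ℝ := (star v ⬝ᵥ A *ᵥ v).re

theorem ofReal_quadForm {A : Matrix m m ℂ} (hA : A.IsHermitian) (v : m → ℂ) :
    (quadForm A v : ℂ) = star v ⬝ᵥ A *ᵥ v := by
  apply Complex.ext
  · simp [quadForm]
  · simpa using (hA.im_star_dotProduct_mulVec_self v).symm

theorem quadForm_nonneg {A : Matrix m m ℂ} (hA : A.PosSemidef) (v : m → ℂ) :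
    0 ≤ quadForm A v :=
  (Complex.nonneg_iff.mp (hA.dotProduct_mulVec_nonneg v)).1

/-- Turns the operator order into real inequalities affine in `t`, from which closedness,
monotonicity and multiplicativity are read off. -/
theorem posSemidef_smul_sub_iff {A B : Matrix m m ℂ} (hA : A.IsHermitian) (hB : B.IsHermitian)
    (t : ℝ) :
    ((t : ℂ) • B - A).PosSemidef ↔ ∀ v, quadForm A v ≤ t * quadForm B v := by
  have hH : ((t : ℂ) • B - A).IsHermitian := by
    refine IsHermitian.sub ?_ hA
    rw [IsHermitian, conjTranspose_smul, hB.eq]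
    simp
  have key : ∀ v, quadForm ((t : ℂ) • B - A) v = t * quadForm B v - quadForm A v := by
    intro v
    simp [quadForm, sub_mulVec, smul_mulVec, dotProduct_sub, dotProduct_smul]
  constructor
  · intro h v
    have := quadForm_nonneg h v
    rw [key] at this
    linarith
  · intro h
    refine PosSemidef.of_dotProduct_mulVec_nonneg hH fun v => ?_
    rw [← ofReal_quadForm hH, key]
    exact_mod_cast sub_nonneg.mpr (h v)

theorem PosSemidef.exists_eq_conjTranspose_mul_self {A : Matrix m m ℂ} (hA : A.PosSemidef) :
    ∃ C : Matrix m m ℂ, A = Cᴴ * C := by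
  classical
  open scoped MatrixOrder Matrix.Norms.L2Operator in
  exact CStarAlgebra.nonneg_iff_eq_star_mul_self.mp hA.nonneg

/-- The pinching inequality for the completely dephased matrix. -/
theorem posSemidef_card_smul_diagonal_sub [DecidableEq m] {A : Matrix m m ℂ} (hA : A.PosSemidef) :
    (((Fintype.card m : ℝ) : ℂ) • diagonal (fun i => A i i) - A).PosSemidef := by
  have hD : (diagonal fun i => A i i).PosSemidef := PosSemidef.diagonal fun i => hA.diag_nonneg
  rw [posSemidef_smul_sub_iff hA.1 hD.1]
  intro v
  -- Each row `l` of `C` contributes `|∑ᵢ C l i v i|²` to one side and `∑ᵢ |C l i v i|²` to the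
  -- other; Cauchy–Schwarz supplies the factor `card m`.
  obtain ⟨C, rfl⟩ := PosSemidef.exists_eq_conjTranspose_mul_self hA
  have h1 : quadForm (Cᴴ * C) v = ∑ l, ‖∑ i, C l i * v i‖ ^ 2 := by
    have : star v ⬝ᵥ (Cᴴ * C) *ᵥ v = star (C *ᵥ v) ⬝ᵥ (C *ᵥ v) := by
      rw [star_mulVec, ← dotProduct_mulVec, mulVec_mulVec]
    rw [quadForm, this, dotProduct, Complex.re_sum]
    refine Finset.sum_congr rfl fun l _ => ?_
    rw [Pi.star_apply, RCLike.star_def, RCLike.conj_mul]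
    norm_cast
  have h2 : quadForm (diagonal fun i => (Cᴴ * C) i i) v = ∑ l, ∑ i, ‖C l i * v i‖ ^ 2 := by
    rw [Finset.sum_comm, quadForm, dotProduct, Complex.re_sum]
    refine Finset.sum_congr rfl fun i _ => ?_
    rw [mulVec_diagonal, mul_apply, Finset.sum_mul, Finset.mul_sum, Complex.re_sum]
    refine Finset.sum_congr rfl fun l _ => ?_
    have : star v i * (Cᴴ i l * C l i * v i) = star (C l i * v i) * (C l i * v i) := by
      simp; ring
    rw [this, RCLike.star_def, RCLike.conj_mul]
    norm_cast
  rw [h1, h2, Finset.mul_sum]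
  refine Finset.sum_le_sum fun l _ => ?_
  calc ‖∑ i, C l i * v i‖ ^ 2 ≤ (∑ i, ‖C l i * v i‖) ^ 2 := by
        gcongr
        exact norm_sum_le _ _
    _ ≤ _ := by simpa using sq_sum_le_card_mul_sum_sq (s := Finset.univ)
                  (f := fun i => ‖C l i * v i‖)

/-- Contraction of two positive semidefinite matrices over a common tensor factor. -/
theorem posSemidef_contract {X : Matrix (k × c) (k × c) ℂ} {J : Matrix (c × d) (c × d) ℂ}
    (hX : X.PosSemidef) (hJ : J.PosSemidef) :
    (Matrix.of fun p q : k × d => ∑ x, ∑ x', X (p.1, x) (q.1, x') * J (x, p.2) (x', q.2)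
      ).PosSemidef := by
  classical
  -- `V` inserts the unnormalised maximally entangled vector on the two copies of `c`, so the
  -- contraction is a compression of `X ⊗ J`.
  let V : Matrix ((k × c) × (c × d)) (k × d) ℂ := Matrix.of fun r p =>
    if r.1.1 = p.1 ∧ r.1.2 = r.2.1 ∧ r.2.2 = p.2 then 1 else 0
  have key : (Matrix.of fun p q : k × d =>
      ∑ x, ∑ x', X (p.1, x) (q.1, x') * J (x, p.2) (x', q.2)) = Vᴴ * (X ⊗ₖ J) * V := by
    ext ⟨p, y⟩ ⟨q, y'⟩
    simp only [of_apply, mul_apply, conjTranspose_apply, V, kroneckerMap_apply,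
      Fintype.sum_prod_type, apply_ite star, star_one, star_zero, ite_and, Finset.sum_mul]
    simp
    rw [Finset.sum_comm]
  rw [key]
  exact (hX.kronecker hJ).conjTranspose_mul_mul_same V

/-- The tensor product of a finite family of matrices. -/
def piTensor {n : ℕ} (M : Fin n → Matrix m m ℂ) : Matrix (Fin n → m) (Fin n → m) ℂ :=
  Matrix.of fun x y => ∏ i, M i (x i) (y i)

theorem posSemidef_piTensor {n : ℕ} {M : Fin n → Matrix m m ℂ} (hM : ∀ i, (M i).PosSemidef) :
    (piTensor M).PosSemidef := by
  classical
  choose C hC using fun i => PosSemidef.exists_eq_conjTranspose_mul_self (hM i)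
  convert posSemidef_conjTranspose_mul_self (piTensor C) using 1
  ext x y
  simp only [piTensor, of_apply, mul_apply, conjTranspose_apply, star_prod,
    ← Finset.prod_mul_distrib, hC]
  rw [Fintype.prod_sum]

theorem quadForm_piTensor {n : ℕ} {A : Matrix m m ℂ} (hA : A.IsHermitian) (v : m → ℂ) :
    quadForm (piTensor fun _ : Fin n => A) (fun x => ∏ i, v (x i)) = quadForm A v ^ n := by
  have : star (fun x : Fin n → m => ∏ i, v (x i)) ⬝ᵥ (piTensor fun _ : Fin n => A) *ᵥ
      (fun x : Fin n → m => ∏ i, v (x i)) = (star v ⬝ᵥ A *ᵥ v) ^ n := by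
    classical
    calc _ = ∑ x : Fin n → m, ∏ i, (star (v (x i)) * (A *ᵥ v) (x i)) := by
          simp only [dotProduct, mulVec, piTensor, of_apply, Pi.star_apply, star_prod,
            ← Finset.prod_mul_distrib]
          refine Finset.sum_congr rfl fun x _ => ?_
          rw [Finset.prod_mul_distrib, Fintype.prod_sum]
      _ = ∏ _i : Fin n, ∑ j, star (v j) * (A *ᵥ v) j := by rw [Fintype.prod_sum]
      _ = _ := by simp [dotProduct]
  rw [quadForm, this, ← ofReal_quadForm hA]
  norm_cast

/-- Expand the tensor power of `B = A + (B - A)` over the set `S` of positions carrying `A`. The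
term with `S` full is the power of `A`; all the others are positive. -/
theorem piTensor_mono {n : ℕ} {A B : Matrix m m ℂ} (hA : A.PosSemidef)
    (hAB : (B - A).PosSemidef) :
    ((piTensor fun _ : Fin n => B) - piTensor fun _ : Fin n => A).PosSemidef := by
  have key : (piTensor fun _ : Fin n => B) - (piTensor fun _ : Fin n => A)
      = ∑ S ∈ (Finset.univ : Finset (Fin n)).powerset.erase Finset.univ,
        piTensor fun i => if i ∈ S then A else B - A := by
    ext x y
    have h := Finset.prod_add (fun i => A (x i) (y i)) (fun i => (B - A) (x i) (y i))
      (Finset.univ : Finset (Fin n))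
    rw [← Finset.add_sum_erase _ _ (Finset.mem_powerset.2 (Finset.Subset.refl _))] at h
    rw [Matrix.sum_apply, Matrix.sub_apply]
    simp only [piTensor, of_apply]
    rw [sub_eq_iff_eq_add']
    simp only [Matrix.sub_apply, add_sub_cancel, Finset.sdiff_self, Finset.prod_empty, mul_one] at h
    rw [h]
    congr 1
    refine Finset.sum_congr rfl fun S _ => ?_
    rw [← Finset.prod_sdiff (Finset.subset_univ S), mul_comm]
    congr 1
    · refine Finset.prod_congr rfl fun i hi => ?_
      rw [if_neg (Finset.mem_sdiff.1 hi).2, Matrix.sub_apply]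
    · refine Finset.prod_congr rfl fun i hi => ?_
      rw [if_pos hi]
  rw [key]
  refine posSemidef_sum _ fun S _ => posSemidef_piTensor fun i => ?_
  split_ifs
  exacts [hA, hAB]

end Matrices

/-! ### Choi matrices and complete positivity. -/

section Choi

variable {a₀ a₁ : Type} [DecidableEq a₀]

/-- The Choi matrix of a map. -/
def choi (N : MapSpace a₀ a₁) : Matrix (a₀ × a₁) (a₀ × a₁) ℂ :=
  Matrix.of fun p q => N (Matrix.single p.1 q.1 1) p.2 q.2

theorem choi_smul_sub (z : ℂ) (M N : MapSpace a₀ a₁) :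
    choi (z • M - N) = z • choi M - choi N := rfl

variable [Fintype a₀]

theorem apply_eq_sum_choi (N : MapSpace a₀ a₁) (X : Matrix a₀ a₀ ℂ) (y y' : a₁) :
    N X y y' = ∑ x, ∑ x', X x x' * choi N (x, y) (x', y') := by
  conv_lhs => rw [matrix_eq_sum_single X]
  simp only [map_sum, Matrix.sum_apply]
  refine Finset.sum_congr rfl fun x _ => Finset.sum_congr rfl fun x' _ => ?_
  have : single x x' (X x x') = X x x' • single x x' (1 : ℂ) := by simp
  rw [this, map_smul]
  rfl

theorem choi_injective : Function.Injective (choi : MapSpace a₀ a₁ → _) := by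
  intro M N h
  refine LinearMap.ext fun X => ?_
  ext y y'
  rw [apply_eq_sum_choi, apply_eq_sum_choi, h]

variable [Fintype a₁]

/-- Choi's theorem: the Choi matrix is the image of the unnormalised maximally entangled projector,
and conversely `id ⊗ N` contracts its argument with the Choi matrix. -/
theorem isCP_iff_posSemidef_choi {N : MapSpace a₀ a₁} : IsCP N ↔ (choi N).PosSemidef := by
  constructor
  · intro h
    have hX := posSemidef_vecMulVec_self_star (fun p : a₀ × a₀ => if p.1 = p.2 then (1 : ℂ) else 0)
    convert h a₀ _ hX using 1
    ext p q
    have hs : (Matrix.of fun x x' : a₀ => vecMulVec (fun p : a₀ × a₀ => if p.1 = p.2 then (1 : ℂ)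
        else 0) (star fun p : a₀ × a₀ => if p.1 = p.2 then (1 : ℂ) else 0) (p.1, x) (q.1, x')) =
        single p.1 q.1 1 := by
      ext x x'
      simp only [vecMulVec_apply, single_apply, ite_and, of_apply, Pi.star_apply]
      split_ifs <;> simp
    rw [idTensor, of_apply, hs]
    rfl
  · intro h k _ X hX
    convert posSemidef_contract hX h using 1
    ext p q
    simp only [idTensor, of_apply, apply_eq_sum_choi N]

theorem trace_choi (N : MapSpace a₀ a₁) : (choi N).trace = ∑ x, (N (single x x 1)).trace := by
  simp [Matrix.trace, choi, Fintype.sum_prod_type]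

theorem IsChannel.trace_choi {N : MapSpace a₀ a₁} (hN : IsChannel N) :
    (choi N).trace = Fintype.card a₀ := by
  simp [DynCoh.trace_choi, hN.tp]

variable [DecidableEq a₁]

omit [Fintype a₀] [Fintype a₁] in
theorem choi_dephaseSuper (N : MapSpace a₀ a₁) :
    choi (dephaseSuper a₀ a₁ N) = diagonal fun p => choi N p p := by
  have hd : ∀ x x' : a₀, dephase a₀ (single x x' 1) = if x = x' then single x x' (1 : ℂ) else 0 := by
    intro x x'
    ext i j
    simp only [dephase, LinearMap.coe_mk, AddHom.coe_mk, diagonal_apply]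
    split_ifs with h1 h2 h2
    all_goals simp_all [single_apply]
    all_goals grind
  ext ⟨x, y⟩ ⟨x', y'⟩
  simp only [choi, of_apply, dephaseSuper, LinearMap.coe_mk, AddHom.coe_mk, LinearMap.comp_apply, hd]
  by_cases hx : x = x' <;> by_cases hy : y = y' <;> simp [hx, hy, dephase]

theorem IsCP.dephaseSuper {N : MapSpace a₀ a₁} (hN : IsCP N) :
    IsCP (dephaseSuper a₀ a₁ N) := by
  rw [isCP_iff_posSemidef_choi, choi_dephaseSuper]
  exact PosSemidef.diagonal fun _ => (isCP_iff_posSemidef_choi.1 hN).diag_nonneg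

theorem trace_dephase (X : Matrix a₁ a₁ ℂ) : (dephase a₁ X).trace = X.trace := by
  simp [dephase, Matrix.trace]

theorem IsChannel.dephaseSuper {N : MapSpace a₀ a₁} (hN : IsChannel N) :
    IsChannel (dephaseSuper a₀ a₁ N) where
  cp := hN.cp.dephaseSuper
  tp X := by
    change (dephase a₁ (N (dephase a₀ X))).trace = _
    rw [trace_dephase, hN.tp, trace_dephase]

omit [Fintype a₁] in
theorem dephaseSuper_dephaseSuper (N : MapSpace a₀ a₁) :
    DynCoh.dephaseSuper a₀ a₁ (DynCoh.dephaseSuper a₀ a₁ N) = DynCoh.dephaseSuper a₀ a₁ N := by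
  apply choi_injective
  simp [choi_dephaseSuper]

/-! ### The set of dominating factors -/

theorem mem_dominationSet_iff {N : MapSpace a₀ a₁} (hN : IsCP N) {t : ℝ} :
    t ∈ dominationSet N (DynCoh.dephaseSuper a₀ a₁ N) ↔
      ∀ v, quadForm (choi N) v ≤ t * quadForm (diagonal fun p => choi N p p) v := by
  have hP := isCP_iff_posSemidef_choi.1 hN
  have hQ := isCP_iff_posSemidef_choi.1 hN.dephaseSuper
  rw [choi_dephaseSuper] at hQ
  rw [← posSemidef_smul_sub_iff hP.1 hQ.1, ← choi_dephaseSuper, ← choi_smul_sub,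
    ← isCP_iff_posSemidef_choi]
  rfl

theorem card_mem_dominationSet {N : MapSpace a₀ a₁} (hN : IsCP N) :
    (Fintype.card (a₀ × a₁) : ℝ) ∈ dominationSet N (DynCoh.dephaseSuper a₀ a₁ N) := by
  have hP := isCP_iff_posSemidef_choi.1 hN
  rw [dominationSet, Set.mem_ofPred_eq, isCP_iff_posSemidef_choi, choi_smul_sub, choi_dephaseSuper]
  exact posSemidef_card_smul_diagonal_sub hP

theorem mem_dominationSet_of_le {N : MapSpace a₀ a₁} (hN : IsCP N) {s t : ℝ}
    (hs : s ∈ dominationSet N (DynCoh.dephaseSuper a₀ a₁ N)) (hst : s ≤ t) :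
    t ∈ dominationSet N (DynCoh.dephaseSuper a₀ a₁ N) := by
  rw [mem_dominationSet_iff hN] at hs ⊢
  have hQ := isCP_iff_posSemidef_choi.1 hN.dephaseSuper
  rw [choi_dephaseSuper] at hQ
  exact fun v => (hs v).trans (mul_le_mul_of_nonneg_right hst (quadForm_nonneg hQ v))

/-- Compare traces: the Choi matrices of `N` and `Δ[N]` both have trace `|A₀|`, which is positive
since `A₀` is nonempty. -/
theorem one_le_of_mem_dominationSet [Nonempty a₀] {N : MapSpace a₀ a₁} (hN : IsChannel N) {t : ℝ}
    (ht : t ∈ dominationSet N (DynCoh.dephaseSuper a₀ a₁ N)) : 1 ≤ t := by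
  have h := (isCP_iff_posSemidef_choi.1 ht).trace_nonneg
  rw [choi_smul_sub, trace_sub, trace_smul, hN.trace_choi, hN.dephaseSuper.trace_choi] at h
  have h' : (0 : ℝ) ≤ t * Fintype.card a₀ - Fintype.card a₀ := by
    have := (Complex.nonneg_iff.1 h).1
    simpa using this
  have hc : (0 : ℝ) < Fintype.card a₀ := by exact_mod_cast Fintype.card_pos
  by_contra hlt
  nlinarith

theorem bddBelow_dominationSet [Nonempty a₀] {N : MapSpace a₀ a₁} (hN : IsChannel N) :
    BddBelow (dominationSet N (DynCoh.dephaseSuper a₀ a₁ N)) :=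
  ⟨1, fun _ ht => one_le_of_mem_dominationSet hN ht⟩

/-- The set is an intersection of closed conditions, one for each vector; pinching makes it nonempty
and the trace bound makes it bounded below. -/
theorem isLeast_dominationSet [Nonempty a₀] {N : MapSpace a₀ a₁} (hN : IsChannel N) :
    IsLeast (dominationSet N (DynCoh.dephaseSuper a₀ a₁ N))
      (sInf (dominationSet N (DynCoh.dephaseSuper a₀ a₁ N))) := by
  have hcl : IsClosed (dominationSet N (DynCoh.dephaseSuper a₀ a₁ N)) := by
    have : dominationSet N (DynCoh.dephaseSuper a₀ a₁ N) =
        {t | ∀ v, quadForm (choi N) v ≤ t * quadForm (diagonal fun p => choi N p p) v} :=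
      Set.ext fun t => mem_dominationSet_iff hN.cp
    rw [this, Set.ofPred_forall]
    exact isClosed_iInter fun v => isClosed_le (by fun_prop) (by fun_prop)
  exact ⟨hcl.csInf_mem ⟨_, card_mem_dominationSet hN.cp⟩ (bddBelow_dominationSet hN),
    fun t ht => csInf_le (bddBelow_dominationSet hN) ht⟩

theorem one_le_sInf_dominationSet [Nonempty a₀] {N : MapSpace a₀ a₁} (hN : IsChannel N) :
    1 ≤ sInf (dominationSet N (DynCoh.dephaseSuper a₀ a₁ N)) :=
  one_le_of_mem_dominationSet hN (isLeast_dominationSet hN).1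

theorem rpow_dephasingLogRobustness [Nonempty a₀] {N : MapSpace a₀ a₁} (hN : IsChannel N) :
    (2 : ℝ) ^ dephasingLogRobustness N = sInf (dominationSet N (DynCoh.dephaseSuper a₀ a₁ N)) :=
  Real.rpow_logb two_pos (by norm_num) (one_pos.trans_le (one_le_sInf_dominationSet hN))

/-! ### Tensor powers -/

omit [Fintype a₁] [DecidableEq a₁] in
theorem choi_tensorPow (N : MapSpace a₀ a₁) (n : ℕ) :
    choi (tensorPow N n) = (piTensor fun _ : Fin n => choi N).submatrix
      (Equiv.arrowProdEquivProdArrow (Fin n) (fun _ => a₀) (fun _ => a₁)).symm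
      (Equiv.arrowProdEquivProdArrow (Fin n) (fun _ => a₀) (fun _ => a₁)).symm := by
  ext ⟨x, y⟩ ⟨x', y'⟩
  simp only [choi, tensorPow, of_apply, LinearMap.coe_mk, AddHom.coe_mk, submatrix_apply, piTensor]
  simp [single_apply, ite_and, Equiv.arrowProdEquivProdArrow]

omit [DecidableEq a₁] in
theorem IsChannel.tensorPow {N : MapSpace a₀ a₁} (hN : IsChannel N) (n : ℕ) :
    IsChannel (tensorPow N n) where
  cp := by
    rw [isCP_iff_posSemidef_choi, choi_tensorPow]
    exact (posSemidef_piTensor fun _ => isCP_iff_posSemidef_choi.1 hN.cp).submatrix _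
  tp X := by
    have h : ∀ x x' : Fin n → a₀,
        ∑ y : Fin n → a₁, ∏ i, N (single (x i) (x' i) 1) (y i) (y i) = if x = x' then 1 else 0 := by
      intro x x'
      rw [← Fintype.prod_sum (fun i y => N (single (x i) (x' i) 1) y y)]
      have : ∀ i, ∑ y, N (single (x i) (x' i) 1) y y = if x i = x' i then 1 else 0 := by
        intro i
        refine (hN.tp (single (x i) (x' i) 1)).trans ?_
        split_ifs with hi
        · rw [hi]; simp
        · exact trace_single_eq_of_ne _ _ _ hi
      simp_rw [this, Finset.prod_ite_zero, funext_iff]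
      simp
    simp only [Matrix.trace, diag_apply, DynCoh.tensorPow, LinearMap.coe_mk, AddHom.coe_mk, of_apply]
    rw [Finset.sum_comm]
    refine Finset.sum_congr rfl fun x _ => ?_
    rw [Finset.sum_comm]
    simp_rw [← Finset.mul_sum, h]
    simp

/-- The smallest dominating factor is multiplicative under tensor powers. -/
theorem sInf_dominationSet_tensorPow [Nonempty a₀] {N : MapSpace a₀ a₁} (hN : IsChannel N)
    (n : ℕ) :
    sInf (dominationSet (tensorPow N n) (DynCoh.dephaseSuper _ _ (tensorPow N n))) =
      sInf (dominationSet N (DynCoh.dephaseSuper a₀ a₁ N)) ^ n := by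
  set t := sInf (dominationSet N (DynCoh.dephaseSuper a₀ a₁ N)) with ht
  set A := choi N with hA
  set B := diagonal fun p => A p p with hB
  have hAp : A.PosSemidef := isCP_iff_posSemidef_choi.1 hN.cp
  have hBp : B.PosSemidef := PosSemidef.diagonal fun _ => hAp.diag_nonneg
  have hAn : (piTensor fun _ : Fin n => A).PosSemidef := posSemidef_piTensor fun _ => hAp
  have hBn : (piTensor fun _ : Fin n => B).PosSemidef := posSemidef_piTensor fun _ => hBp
  have ht1 : 1 ≤ t := one_le_sInf_dominationSet hN
  have hdiag : (diagonal fun p => choi (tensorPow N n) p p) =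
      (piTensor fun _ : Fin n => B).submatrix
        (Equiv.arrowProdEquivProdArrow (Fin n) (fun _ => a₀) (fun _ => a₁)).symm
        (Equiv.arrowProdEquivProdArrow (Fin n) (fun _ => a₀) (fun _ => a₁)).symm := by
    rw [choi_tensorPow]
    ext p q
    simp only [diagonal_apply, submatrix_apply, piTensor, of_apply, hB]
    rw [Finset.prod_ite_zero]
    have : (∀ i ∈ (Finset.univ : Finset (Fin n)),
        (Equiv.arrowProdEquivProdArrow (Fin n) (fun _ => a₀) (fun _ => a₁)).symm p i =
        (Equiv.arrowProdEquivProdArrow (Fin n) (fun _ => a₀) (fun _ => a₁)).symm q i) ↔ p = q := by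
      rw [← (Equiv.arrowProdEquivProdArrow (Fin n) (fun _ => a₀) (fun _ => a₁)).symm.apply_eq_iff_eq,
        funext_iff]
      simp
    simp only [this]
    split_ifs with h
    · rw [h]
    · rfl
  have hmem : ∀ s : ℝ,
      s ∈ dominationSet (tensorPow N n) (DynCoh.dephaseSuper _ _ (tensorPow N n)) ↔
        ∀ v, quadForm (piTensor fun _ : Fin n => A) v ≤
          s * quadForm (piTensor fun _ : Fin n => B) v := by
    intro s
    rw [← posSemidef_smul_sub_iff hAn.1 hBn.1, dominationSet, Set.mem_ofPred_eq,
      isCP_iff_posSemidef_choi, choi_smul_sub, choi_dephaseSuper, hdiag, choi_tensorPow,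
      ← posSemidef_submatrix_equiv
        (Equiv.arrowProdEquivProdArrow (Fin n) (fun _ => a₀) (fun _ => a₁)).symm]
    rfl
  have hleast := isLeast_dominationSet (hN.tensorPow n)
  refine le_antisymm (hleast.2 ?_) ?_
  -- Upper bound: `A ≤ t B` passes to tensor powers.
  · have hAB : ((t : ℂ) • B - A).PosSemidef :=
      (posSemidef_smul_sub_iff hAp.1 hBp.1 t).2
        ((mem_dominationSet_iff hN.cp).1 (isLeast_dominationSet hN).1)
    have := piTensor_mono (n := n) hAp hAB
    rw [hmem, ← posSemidef_smul_sub_iff hAn.1 hBn.1]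
    convert this using 2
    ext x y
    simp [piTensor, Finset.prod_mul_distrib]
  · set s := sInf (dominationSet (tensorPow N n) (DynCoh.dephaseSuper _ _ (tensorPow N n)))
    -- Lower bound: a vector `v` violating domination at `r < t` gives the product vector `v ⊗ ⋯ ⊗
    -- v`, which forces `r ^ n ≤ s`. Letting `r` increase to `t` avoids the need for an optimal
    -- vector.
    have hlt : ∀ r : ℝ, 0 ≤ r → r < t → r ^ n ≤ s := by
      intro r hr hrt
      have hr' : r ∉ dominationSet N (DynCoh.dephaseSuper a₀ a₁ N) := fun h =>
        absurd ((isLeast_dominationSet hN).2 h) (not_le.2 hrt)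
      rw [mem_dominationSet_iff hN.cp] at hr'
      push Not at hr'
      obtain ⟨v, hv⟩ := hr'
      have h1 := (mem_dominationSet_iff hN.cp).1 (isLeast_dominationSet hN).1 v
      have h2 := quadForm_nonneg hBp v
      -- If the form of `B` vanished at `v`, domination at `t` would make that of `A` nonpositive,
      -- against the violation at `r`.
      have h3 : 0 < quadForm B v := by
        rcases h2.lt_or_eq with h | h
        · exact h
        · rw [← hB, ← h, mul_zero] at h1 hv
          linarith
      have h4 := (hmem s).1 hleast.1 fun x => ∏ i, v (x i)
      rw [quadForm_piTensor hAp.1, quadForm_piTensor hBp.1] at h4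
      have h5 : (r * quadForm B v) ^ n ≤ quadForm A v ^ n :=
        pow_le_pow_left₀ (mul_nonneg hr h2) hv.le n
      rw [mul_pow] at h5
      exact le_of_mul_le_mul_right (h5.trans h4) (pow_pos h3 n)
    have hc : Filter.Tendsto (fun r : ℝ => r ^ n) (nhdsWithin t (Set.Iio t)) (nhds (t ^ n)) :=
      ((continuous_pow n).tendsto t).mono_left nhdsWithin_le_nhds
    refine le_of_tendsto hc ?_
    filter_upwards [Ioo_mem_nhdsLT (show (0 : ℝ) < t by linarith)] with r hr
    exact hlt r hr.1.le hr.2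

end Choi

/-! ### Superchannels on states; measure-and-prepare superchannels. -/

section Superchannels

variable {a₀ a₁ b₀ b₁ r : Type} [Fintype a₀] [DecidableEq a₀] [Fintype a₁]
  [Fintype b₀] [DecidableEq b₀] [Fintype b₁] [Fintype r]

/-- A map, viewed as a bipartite map with trivial first system. -/
def extendUnit (M : MapSpace a₀ a₁) : MapSpace (Unit × a₀) (Unit × a₁) where
  toFun X := (M (X.submatrix (Prod.mk ()) (Prod.mk ()))).submatrix Prod.snd Prod.snd
  map_add' X Y := by rw [submatrix_add, Pi.add_apply, Pi.add_apply, map_add]; rfl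
  map_smul' z X := by rw [submatrix_smul, Pi.smul_apply, Pi.smul_apply, map_smul]; rfl

theorem IsChannel.extendUnit {M : MapSpace a₀ a₁} (hM : IsChannel M) :
    IsChannel (extendUnit M) where
  cp := by
    rw [isCP_iff_posSemidef_choi]
    convert (isCP_iff_posSemidef_choi.1 hM.cp).submatrix
      (fun p : (Unit × a₀) × (Unit × a₁) => (p.1.2, p.2.2)) using 1
    ext p q
    have : (single p.1 q.1 (1 : ℂ)).submatrix (Prod.mk ()) (Prod.mk ()) =
        single p.1.2 q.1.2 1 := by
      ext x x'
      simp [single_apply, Prod.ext_iff]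
    simp [choi, DynCoh.extendUnit, this]
  tp X := by
    have h := hM.tp (X.submatrix (Prod.mk ()) (Prod.mk ()))
    simpa [Matrix.trace, DynCoh.extendUnit, Fintype.sum_prod_type] using h

omit [Fintype a₀] [DecidableEq a₀] [Fintype a₁] in
theorem block_extendUnit (M : MapSpace a₀ a₁) : block (extendUnit M) () () () () = M := by
  refine LinearMap.ext fun X => ?_
  ext y y'
  have : (single () () (1 : ℂ) ⊗ₖ X).submatrix (Prod.mk ()) (Prod.mk ()) = X := by
    ext x x'
    simp
  simp [block, extendUnit, this]

/-- This is the case of a trivial system `R` in the definition of a superchannel. -/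
theorem IsSuperchannel.isCP_apply {Θ : Supermap a₀ a₁ b₀ b₁} (hΘ : IsSuperchannel Θ)
    {M : MapSpace a₀ a₁} (hM : IsChannel M) : IsCP (Θ M) := by
  have h := isCP_iff_posSemidef_choi.1 (hΘ Unit Unit _ hM.extendUnit).cp
  rw [isCP_iff_posSemidef_choi]
  convert h.submatrix (fun p : b₀ × b₁ => (((), p.1), ((), p.2))) using 1
  ext p q
  have : (Matrix.of fun b b' => single ((), p.1) ((), q.1) (1 : ℂ) ((), b) ((), b')) =
      single p.1 q.1 1 := by
    ext x x'
    simp [single_apply]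
  simp [choi, idTensorSuper, block_extendUnit, this]

theorem isChannel_preparation {ρ : Matrix r r ℂ} (hρ : ρ.PosSemidef) (ht : ρ.trace = 1) :
    IsChannel (preparation ρ) where
  cp := by
    rw [isCP_iff_posSemidef_choi]
    convert hρ.submatrix (Prod.snd : Unit × r → r) using 1
    ext p q
    simp [choi, preparation]
  tp X := by
    change (X () () • ρ).trace = _
    rw [trace_smul, ht]
    simp [Matrix.trace]

omit [Fintype r] in
theorem preparation_smul_sub (z : ℂ) (ρ σ : Matrix r r ℂ) :
    preparation (z • ρ - σ) = z • preparation ρ - preparation σ := by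
  refine LinearMap.ext fun X => ?_
  change X () () • (z • ρ - σ) = z • (X () () • ρ) - X () () • σ
  rw [smul_sub, smul_comm]

/-- Superchannels are tested on channels only, that is on states of trace one; rescaling by the
trace covers other positive operators, with trace zero apart. -/
theorem IsSuperchannel.isCP_preparation {Θ : Supermap Unit r b₀ b₁} (hΘ : IsSuperchannel Θ)
    {ρ : Matrix r r ℂ} (hρ : ρ.PosSemidef) : IsCP (Θ (preparation ρ)) := by
  by_cases h0 : ρ.trace = 0
  · have h0' : ρ = 0 := hρ.trace_eq_zero_iff.1 h0
    have h1 : preparation ρ = 0 := by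
      refine LinearMap.ext fun X => ?_
      simp [h0', preparation]
    rw [h1, map_zero, isCP_iff_posSemidef_choi]
    exact PosSemidef.zero
  · have hpos : 0 ≤ (ρ.trace)⁻¹ := inv_nonneg.2 hρ.trace_nonneg
    have h1 := hΘ.isCP_apply (isChannel_preparation (hρ.smul hpos)
      (by rw [trace_smul, smul_eq_mul, inv_mul_cancel₀ h0]))
    have h2 : preparation ρ = ρ.trace • preparation ((ρ.trace)⁻¹ • ρ) := by
      refine LinearMap.ext fun X => ?_
      change X () () • ρ = ρ.trace • (X () () • ((ρ.trace)⁻¹ • ρ))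
      rw [smul_comm, smul_inv_smul₀ h0]
    rw [h2, map_smul, isCP_iff_posSemidef_choi]
    exact (isCP_iff_posSemidef_choi.1 h1).smul hρ.trace_nonneg

omit [Fintype r] in
theorem dephaseSuper_preparation [DecidableEq r] (ρ : Matrix r r ℂ) :
    dephaseSuper Unit r (preparation ρ) = preparation (diagonal fun i => ρ i i) := by
  refine LinearMap.ext fun X => ?_
  ext i j
  by_cases h : i = j <;> simp [dephaseSuper, dephase, preparation, h]

/-- The supermap `M ↦ Tr(P M(1)) N` from states. -/
def effectSuper (P : Matrix r r ℂ) (N : MapSpace b₀ b₁) : Supermap Unit r b₀ b₁ where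
  toFun M := (P * M 1).trace • N
  map_add' M M' := by rw [LinearMap.add_apply, Matrix.mul_add, trace_add, add_smul]
  map_smul' z M := by
    rw [LinearMap.smul_apply, Matrix.mul_smul, trace_smul, smul_assoc, RingHom.id_apply]

omit [Fintype a₀] [DecidableEq a₀] [Fintype a₁] [Fintype b₀] [DecidableEq b₀] [Fintype b₁] in
theorem idTensorSuper_add_left {r₀ r₁ : Type} [Fintype r₀] [DecidableEq r₀]
    (Θ Θ' : Supermap a₀ a₁ b₀ b₁) (M : MapSpace (r₀ × a₀) (r₁ × a₁)) :
    idTensorSuper (Θ + Θ') M = idTensorSuper Θ M + idTensorSuper Θ' M := by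
  refine LinearMap.ext fun X => ?_
  ext p q
  simp [idTensorSuper, Finset.sum_add_distrib]

section

variable {r₀ r₁ : Type} [Fintype r₀] [DecidableEq r₀] [Fintype r₁]
  (P : Matrix r r ℂ) (N : MapSpace b₀ b₁) (M : MapSpace (r₀ × Unit) (r₁ × r))

theorem isCP_idTensorSuper_effectSuper {P : Matrix r r ℂ}
    {N : MapSpace b₀ b₁} {M : MapSpace (r₀ × Unit) (r₁ × r)} (hP : P.PosSemidef) (hN : IsCP N)
    (hM : IsCP M) : IsCP (idTensorSuper (effectSuper P N) M) := by
  rw [isCP_iff_posSemidef_choi] at hN hM ⊢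
  have hX := hM.submatrix (fun p : (r₀ × r₁) × r => ((p.1.1, ()), (p.1.2, p.2)))
  -- The transpose matches the index order in `Tr(P M)`. The Choi matrix of the output is this
  -- contraction tensored with that of `N`.
  have hJ := hP.transpose.submatrix (Prod.fst : r × Unit → r)
  have hK := (posSemidef_contract hX hJ).submatrix (fun p : r₀ × r₁ => (p, ()))
  refine (congrArg PosSemidef ?_).mpr ((hK.kronecker hN).submatrix
    (fun p : (r₀ × b₀) × (r₁ × b₁) => ((p.1.1, p.2.1), (p.1.2, p.2.2))))
  ext ⟨⟨i, b⟩, ⟨k, y⟩⟩ ⟨⟨j, b'⟩, ⟨l, y'⟩⟩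
  have h1 : ∀ i' j' : r₀, (Matrix.of fun x x' => single (i, b) (j, b') (1 : ℂ) (i', x) (j', x')) =
      if i = i' then (if j = j' then single b b' 1 else 0) else 0 := by
    intro i' j'
    ext x x'
    split_ifs with hi hj <;> simp [single_apply, *]
  have h2 : single i j (1 : ℂ) ⊗ₖ (1 : Matrix Unit Unit ℂ) = single (i, ()) (j, ()) 1 := by
    ext x x'
    simp [single_apply, Prod.ext_iff]
  have h3 : (P * block M i j k l 1).trace =
      ∑ x, ∑ x', choi M ((i, ()), (k, x)) ((j, ()), (l, x')) * P x' x := by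
    rw [Finset.sum_comm]
    simp only [Matrix.trace, diag_apply, mul_apply, block, LinearMap.coe_mk, AddHom.coe_mk, of_apply,
      h2, choi]
    exact Finset.sum_congr rfl fun _ _ => Finset.sum_congr rfl fun _ _ => mul_comm _ _
  have h4 : choi (idTensorSuper (effectSuper P N) M) ((i, b), (k, y)) ((j, b'), (l, y')) =
      (P * block M i j k l 1).trace * choi N (b, y) (b', y') := by
    simp only [choi, idTensorSuper, effectSuper, LinearMap.coe_mk, AddHom.coe_mk, of_apply, h1]
    rw [Finset.sum_eq_single i, Finset.sum_eq_single j]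
    · simp
    · intro j' _ hj'
      simp [hj'.symm]
    · simp
    · intro i' _ hi'
      simp [hi'.symm]
    · simp
  rw [h4, h3]
  simp

omit [DecidableEq b₀] in
-- Trace preservation eliminates `N` from the right-hand side, so the contributions of `P` and `1 -
-- P` can be added although they prepare different channels.
theorem trace_idTensorSuper_effectSuper (Y : Matrix (r₀ × b₀) (r₀ × b₀) ℂ)
    (hN : IsChannel N) :
    (idTensorSuper (effectSuper P N) M Y).trace =
      ∑ i, ∑ j, (∑ k, (P * block M i j k k 1).trace) *
        (Matrix.of fun b b' => Y (i, b) (j, b')).trace := by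
  have h : ∀ i j, (∑ k, (P * block M i j k k 1).trace) *
      (Matrix.of fun b b' => Y (i, b) (j, b')).trace = ∑ k, ∑ y, (P * block M i j k k 1).trace *
        N (Matrix.of fun b b' => Y (i, b) (j, b')) y y := by
    intro i j
    rw [← hN.tp, Finset.sum_mul]
    simp only [Matrix.trace, Finset.mul_sum, diag_apply]
  simp only [h]
  simp only [Matrix.trace, diag_apply, idTensorSuper, LinearMap.coe_mk, AddHom.coe_mk, of_apply,
    effectSuper, LinearMap.smul_apply, Matrix.smul_apply, smul_eq_mul]
  rw [Finset.sum_comm]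
  refine Finset.sum_congr rfl fun i _ => ?_
  rw [Finset.sum_comm]
  refine Finset.sum_congr rfl fun j _ => ?_
  rw [Fintype.sum_prod_type]

end

/-- Measuring the effect `P` and preparing the channel `N` or `E` according to the outcome is a
superchannel. -/
theorem isSuperchannel_measure_prepare [DecidableEq r] {P : Matrix r r ℂ} (hP : P.PosSemidef)
    (hP' : (1 - P).PosSemidef) {N E : MapSpace b₀ b₁} (hN : IsChannel N) (hE : IsChannel E) :
    IsSuperchannel (effectSuper P N + effectSuper (1 - P) E) := by
  intro r₀ r₁ _ _ _ M hM
  rw [idTensorSuper_add_left]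
  refine ⟨?_, fun Y => ?_⟩
  · rw [isCP_iff_posSemidef_choi]
    exact (isCP_iff_posSemidef_choi.1 (isCP_idTensorSuper_effectSuper hP hN.cp hM.cp)).add
      (isCP_iff_posSemidef_choi.1 (isCP_idTensorSuper_effectSuper hP' hE.cp hM.cp))
  · rw [LinearMap.add_apply, trace_add, trace_idTensorSuper_effectSuper _ _ _ _ hN,
      trace_idTensorSuper_effectSuper _ _ _ _ hE]
    simp only [← Finset.sum_add_distrib, ← add_mul, ← trace_add, add_sub_cancel,
      Matrix.one_mul]
    -- With the effects summed to `1`, only trace preservation of `M` remains.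
    have h : ∀ i j, ∑ k, (block M i j k k 1).trace = if i = j then 1 else 0 := by
      intro i j
      have h1 := hM.tp (single i j (1 : ℂ) ⊗ₖ (1 : Matrix Unit Unit ℂ))
      have h2 : (single i j (1 : ℂ)).trace = if i = j then 1 else 0 := by
        split_ifs with hij
        · rw [hij, trace_single_eq_same]
        · exact trace_single_eq_of_ne _ _ _ hij
      rw [trace_kronecker, h2, trace_one, Fintype.card_unit, Nat.cast_one, mul_one] at h1
      rw [← h1]
      simp only [Matrix.trace, diag_apply, block, LinearMap.coe_mk, AddHom.coe_mk, of_apply,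
        Fintype.sum_prod_type]
    simp only [h, ite_mul, one_mul, zero_mul, Finset.sum_ite_eq, Finset.mem_univ, if_true]
    simp [Matrix.trace, Fintype.sum_prod_type]

end Superchannels

/-! ### The maximally coherent state. -/

theorem posSemidef_plusState (m : ℕ) : (plusState m).PosSemidef := by
  have h := (posSemidef_vecMulVec_self_star (fun _ : Fin m => (1 : ℂ))).smul
    (inv_nonneg.2 (Nat.cast_nonneg (α := ℂ) m))
  refine (congrArg PosSemidef ?_).mpr h
  ext i j
  simp [plusState, vecMulVec_apply]

theorem plusState_mul_self {m : ℕ} (hm : 0 < m) : plusState m * plusState m = plusState m := by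
  have : (m : ℂ) ≠ 0 := by exact_mod_cast hm.ne'
  ext i j
  simp [plusState, mul_apply]
  field_simp

theorem trace_plusState {m : ℕ} (hm : 0 < m) : (plusState m).trace = 1 := by
  have : (m : ℂ) ≠ 0 := by exact_mod_cast hm.ne'
  simp [plusState, Matrix.trace, this]

/-- This is pinching for `plusState m`: `m` times its diagonal part is the identity. -/
theorem posSemidef_one_sub_plusState {m : ℕ} (hm : 0 < m) : (1 - plusState m).PosSemidef := by
  have : (m : ℂ) ≠ 0 := by exact_mod_cast hm.ne'
  have h := posSemidef_card_smul_diagonal_sub (posSemidef_plusState m)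
  refine (congrArg PosSemidef ?_).mpr h
  congr 1
  ext i j
  by_cases hij : i = j <;> simp [plusState, one_apply, hij, this]

theorem trace_plusState_mul_diagonal {m : ℕ} (ρ : Matrix (Fin m) (Fin m) ℂ) :
    (plusState m * diagonal fun i => ρ i i).trace = (m : ℂ)⁻¹ * ρ.trace := by
  simp [plusState, Matrix.trace, Finset.mul_sum]

/-! ### The single-shot cost: converse, achievability, integer rounding. -/

section

variable {a₀ a₁ : Type} [Fintype a₀] [DecidableEq a₀] [Fintype a₁] [DecidableEq a₁]

/-- Apply `Θ` to the pinching inequality for `plusState m`; covariance turns the image of the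
dephased state into `Δ[N]`. -/
theorem mem_dominationSet_of_isDISC {m : ℕ} {N : MapSpace a₀ a₁}
    {Θ : Supermap Unit (Fin m) a₀ a₁} (hΘ : IsDISC Θ)
    (hN : Θ (preparation (plusState m)) = N) :
    (m : ℝ) ∈ dominationSet N (dephaseSuper a₀ a₁ N) := by
  have h1 := hΘ.superchannel.isCP_preparation
    (posSemidef_card_smul_diagonal_sub (posSemidef_plusState m))
  have h2 := LinearMap.congr_fun hΘ.covariant (preparation (plusState m))
  rw [LinearMap.comp_apply, LinearMap.comp_apply, hN, dephaseSuper_preparation] at h2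
  rw [preparation_smul_sub, map_sub, map_smul, hN, ← h2, Fintype.card_fin] at h1
  exact h1

/-- The complementary channel in the measure-and-prepare construction. -/
theorem exists_complement {N : MapSpace a₀ a₁} (hN : IsChannel N) {m : ℕ} (hm : 0 < m)
    (h : (m : ℝ) ∈ dominationSet N (dephaseSuper a₀ a₁ N)) :
    ∃ E : MapSpace a₀ a₁, IsChannel E ∧ dephaseSuper a₀ a₁ E = dephaseSuper a₀ a₁ N ∧
      ((m : ℂ) - 1) • E = (m : ℂ) • dephaseSuper a₀ a₁ N - N := by
  have hcp : IsCP ((m : ℂ) • dephaseSuper a₀ a₁ N - N) := by simpa [dominationSet] using h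
  rcases (Nat.succ_le_iff.2 hm).eq_or_lt with h1 | h1
  -- For `m = 1` the difference `Δ[N] - N` is completely positive with Choi trace zero, so `N =
  -- Δ[N]`; the second outcome has no weight on `φ` and `E = N` serves.
  · refine ⟨N, hN, rfl, ?_⟩
    have hm1 : (m : ℂ) = 1 := by exact_mod_cast h1.symm
    rw [hm1] at hcp ⊢
    have h2 : choi ((1 : ℂ) • dephaseSuper a₀ a₁ N - N) = choi (0 : MapSpace a₀ a₁) := by
      refine (isCP_iff_posSemidef_choi.1 hcp).trace_eq_zero_iff.1 ?_
      rw [choi_smul_sub, trace_sub, trace_smul, hN.trace_choi, hN.dephaseSuper.trace_choi]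
      simp
    rw [choi_injective h2, sub_self, zero_smul]
  · have hm1 : (0 : ℂ) < (m : ℂ) - 1 := by
      rw [sub_pos]
      exact_mod_cast h1
    refine ⟨((m : ℂ) - 1)⁻¹ • ((m : ℂ) • dephaseSuper a₀ a₁ N - N), ⟨?_, fun X => ?_⟩, ?_, ?_⟩
    · rw [isCP_iff_posSemidef_choi] at hcp ⊢
      exact hcp.smul (inv_nonneg.2 hm1.le)
    · rw [LinearMap.smul_apply, LinearMap.sub_apply, LinearMap.smul_apply, trace_smul, trace_sub,
        trace_smul, hN.tp, hN.dephaseSuper.tp, smul_eq_mul, smul_eq_mul]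
      field_simp [hm1.ne']
    · rw [map_smul, map_sub, map_smul, dephaseSuper_dephaseSuper]
      have : (m : ℂ) • dephaseSuper a₀ a₁ N - dephaseSuper a₀ a₁ N =
          ((m : ℂ) - 1) • dephaseSuper a₀ a₁ N := by module
      rw [this, inv_smul_smul₀ hm1.ne']
    · rw [smul_inv_smul₀ hm1.ne']

theorem exists_isDISC {N : MapSpace a₀ a₁} (hN : IsChannel N) {m : ℕ} (hm : 0 < m)
    (h : (m : ℝ) ∈ dominationSet N (dephaseSuper a₀ a₁ N)) :
    ∃ Θ : Supermap Unit (Fin m) a₀ a₁, IsDISC Θ ∧ Θ (preparation (plusState m)) = N := by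
  obtain ⟨E, hE, hEN, hEm⟩ := exists_complement hN hm h
  have hm0 : (m : ℂ) ≠ 0 := by exact_mod_cast hm.ne'
  have hΘ : ∀ M : MapSpace Unit (Fin m),
      (effectSuper (plusState m) N + effectSuper (1 - plusState m) E :
        Supermap Unit (Fin m) a₀ a₁) M =
        (plusState m * M 1).trace • N + ((1 - plusState m) * M 1).trace • E := fun _ => rfl
  refine ⟨effectSuper (plusState m) N + effectSuper (1 - plusState m) E,
    ⟨isSuperchannel_measure_prepare (posSemidef_plusState m) (posSemidef_one_sub_plusState hm)
      hN hE, LinearMap.ext fun M => ?_⟩, ?_⟩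
  · have h1 : dephaseSuper Unit (Fin m) M 1 = diagonal fun i => M 1 i i := by
      have : dephase Unit 1 = 1 := by
        ext i j
        simp [dephase]
      change dephase (Fin m) (M (dephase Unit 1)) = _
      rw [this]
      rfl
    have h2 : (diagonal fun i => M 1 i i).trace = (M 1).trace := trace_dephase (M 1)
    -- Dephasing the output turns both prepared channels into `Δ[N]`, with total weight `Tr M(1)`.
    -- Dephasing the input gives `Tr M(1) / m` times `N + (m - 1) E = m Δ[N]`, which is the same.
    rw [LinearMap.comp_apply, LinearMap.comp_apply, hΘ, hΘ, map_add, map_smul, map_smul, hEN, h1,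
      Matrix.sub_mul, Matrix.sub_mul, Matrix.one_mul, Matrix.one_mul, trace_sub, trace_sub, h2,
      trace_plusState_mul_diagonal, ← add_smul, add_sub_cancel]
    have h3 : (M 1).trace - (m : ℂ)⁻¹ * (M 1).trace =
        (m : ℂ)⁻¹ * (M 1).trace * ((m : ℂ) - 1) := by
      field_simp
    rw [h3, mul_smul _ ((m : ℂ) - 1), hEm, ← smul_add, add_sub_cancel, smul_smul]
    congr 1
    field_simp
  · have h1 : preparation (plusState m) 1 = plusState m := by simp [preparation]
    rw [hΘ, h1, Matrix.sub_mul, Matrix.one_mul, plusState_mul_self hm, trace_plusState hm, sub_self,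
      trace_zero, one_smul, zero_smul, add_zero]

theorem exactCostSet_eq {N : MapSpace a₀ a₁} (hN : IsChannel N) :
    exactCostSet N = {c | ∃ m : ℕ, 0 < m ∧ c = Real.logb 2 m ∧
      (m : ℝ) ∈ dominationSet N (dephaseSuper a₀ a₁ N)} := by
  ext c
  refine exists_congr fun m => and_congr_right fun hm => and_congr_right fun _ => ⟨?_, ?_⟩
  · rintro ⟨Θ, hΘ, hΘN⟩
    exact mem_dominationSet_of_isDISC hΘ hΘN
  · exact exists_isDISC hN hm

/-- The admissible dimensions are the positive integers in an upward closed set with a least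
element, so the smallest is the ceiling of that element. -/
theorem isLeast_exactCostSet [Nonempty a₀] {N : MapSpace a₀ a₁} (hN : IsChannel N) :
    IsLeast (exactCostSet N)
      (Real.logb 2 ⌈sInf (dominationSet N (dephaseSuper a₀ a₁ N))⌉₊) := by
  have h1 := one_le_sInf_dominationSet hN
  have hpos : 0 < ⌈sInf (dominationSet N (dephaseSuper a₀ a₁ N))⌉₊ :=
    Nat.ceil_pos.2 (one_pos.trans_le h1)
  rw [exactCostSet_eq hN]
  refine ⟨⟨_, hpos, rfl, mem_dominationSet_of_le hN.cp (isLeast_dominationSet hN).1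
    (Nat.le_ceil _)⟩, ?_⟩
  rintro c ⟨m, -, rfl, hmem⟩
  refine Real.logb_le_logb_of_le one_lt_two (by exact_mod_cast hpos) ?_
  exact_mod_cast Nat.ceil_le.2 ((isLeast_dominationSet hN).2 hmem)

theorem exactCost_eq [Nonempty a₀] {N : MapSpace a₀ a₁} (hN : IsChannel N) :
    exactCost N = Real.logb 2 ⌈sInf (dominationSet N (dephaseSuper a₀ a₁ N))⌉₊ :=
  (isLeast_exactCostSet hN).csInf_eq

end

/-! ### The asymptotic limit. -/

theorem tendsto_logb_ceil_pow {t : ℝ} (ht : 1 ≤ t) :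
    Filter.Tendsto (fun n : ℕ => (1 / (n : ℝ)) * Real.logb 2 ⌈t ^ n⌉₊) Filter.atTop
      (nhds (Real.logb 2 t)) := by
  have hp : ∀ n : ℕ, 1 ≤ t ^ n := fun n => one_le_pow₀ ht
  have hlim : Filter.Tendsto (fun n : ℕ => Real.logb 2 t + 1 / (n : ℝ)) Filter.atTop
      (nhds (Real.logb 2 t)) := by
    simpa using tendsto_const_nhds.add (tendsto_one_div_atTop_nhds_zero_nat (𝕜 := ℝ))
  refine tendsto_of_tendsto_of_tendsto_of_le_of_le' tendsto_const_nhds hlim ?_ ?_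
  all_goals
    filter_upwards [Filter.eventually_gt_atTop 0] with n hn
    have hn' : (0 : ℝ) < n := by exact_mod_cast hn
    have h0 : 0 < t ^ n := one_pos.trans_le (hp n)
    have hlog : Real.logb 2 (t ^ n) = n * Real.logb 2 t := Real.logb_pow 2 t n
  · have := Real.logb_le_logb_of_le one_lt_two h0 (Nat.le_ceil (t ^ n))
    rw [hlog] at this
    rw [one_div, ← div_eq_inv_mul, le_div_iff₀ hn']
    linarith
  -- As `t ^ n ≥ 1`, rounding up at most doubles it: one extra bit in total, `1 / n` per copy.
  · have h2 : (⌈t ^ n⌉₊ : ℝ) ≤ t ^ n * 2 := by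
      linarith [Nat.ceil_lt_add_one h0.le, hp n]
    have := Real.logb_le_logb_of_le one_lt_two (h0.trans_le (Nat.le_ceil (t ^ n))) h2
    rw [Real.logb_mul h0.ne' two_ne_zero, hlog, Real.logb_self_eq_one one_lt_two] at this
    rw [one_div, ← div_eq_inv_mul, div_le_iff₀ hn', add_mul, inv_mul_cancel₀ hn'.ne']
    linarith

end DynCoh

theorem mainTheorem2 {a₀ a₁ : Type} [Fintype a₀] [DecidableEq a₀] [Nonempty a₀]
    [Fintype a₁] [DecidableEq a₁]
    (N : DynCoh.MapSpace a₀ a₁) (hN : DynCoh.IsChannel N) :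
    IsLeast (DynCoh.dominationSet N (DynCoh.dephaseSuper a₀ a₁ N))
      ((2 : ℝ) ^ DynCoh.dephasingLogRobustness N) ∧
    (∀ n : ℕ, IsLeast (DynCoh.exactCostSet (DynCoh.tensorPow N n))
      (DynCoh.exactCost (DynCoh.tensorPow N n))) ∧
    Filter.Tendsto (fun n : ℕ => (1 / (n : ℝ)) * DynCoh.exactCost (DynCoh.tensorPow N n))
      Filter.atTop (nhds (DynCoh.dephasingLogRobustness N)) := by
  refine ⟨?_, fun n => ?_, ?_⟩
  · rw [DynCoh.rpow_dephasingLogRobustness hN]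
    exact DynCoh.isLeast_dominationSet hN
  · rw [DynCoh.exactCost_eq (hN.tensorPow n)]
    exact DynCoh.isLeast_exactCostSet (hN.tensorPow n)
  · simp_rw [DynCoh.exactCost_eq (hN.tensorPow _), DynCoh.sInf_dominationSet_tensorPow hN]
    exact DynCoh.tendsto_logb_ceil_pow (DynCoh.one_le_sInf_dominationSet hN)
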